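/- Let $K:\mathbb R\to[0,\infty)$ be a bounded function of bounded variation that is left continuous or right continuous and has support contained in $[-T,T]$ for some $T<\infty$, let $f$ be a bounded probability density on $\mathbb R$, and let $B>0$. Write $\|K\|_V$ for the total variation of $K$ over $\mathbb R$ and $\|f\|_\infty=\sup_{x\in\mathbb R}f(x)$, and let $$\mathcal F=\left\{x\mapsto K\left(\frac{t-x}{h}f^{1/2}(x)\right)f^{1/2}(x)\,I(|t-x|<hB)\;:\;t\in\mathbb R,\ h>0\right\}.$$ For a probability measure $Q$ and a class $\mathcal H$ of bounded measurable functions, let $N(\mathcal H,L_2(Q),\varepsilon)$ be the smallest number of closed balls of $L_2(Q)$ of radius $\varepsilon$, with arbitrary centres in $L_2(Q)$, needed to cover $\mathcal H$. Then there is a universal constant $R\ge 1$ (not depending on $K$, $f$, $T$, $B$) such that for every Borel probability measure $Q$ on $\mathbb R$ $$N(\mathcal F,L_2(Q),\varepsilon)\le\left(\frac{R\|K\|_V\|f\|_\infty^{1/2}}{\varepsilon}\right)^{22}\qquad\text{for all } 0<\varepsilon\le R\|K\|_V\|f\|_\infty^{1/2}.$$ Moreover $\mathcal F$ is of VC type with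 respect to the constant envelope $W=\|K\|_V\|f\|_\infty^{1/2}$, with characteristics $A=R$ and $v=22$: the functions in $\mathcal F$ are Borel measurable and bounded in absolute value by $W$, and $N(\mathcal F,L_2(Q),\varepsilon)\le (A\|W\|_{L_2(Q)}/\varepsilon)^{v}$ for every Borel probability measure $Q$ on $\mathbb R$ and all $0<\varepsilon\le\|W\|_{L_2(Q)}$. -/

import Mathlib

open MeasureTheory Set
open scoped ENNReal NNReal

/-- The supremum norm `‖g‖_∞ = sup_x |g x|` (a genuine supremum over all points, since it is
used with arbitrary probability measures; meaningful for bounded `g`). -/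
noncomputable def supNorm (g : ℝ → ℝ) : ℝ := ⨆ x, |g x|

/-- The total variation norm `‖K‖_V` of `K` on the real line (meaningful for `K` of bounded
variation). -/
noncomputable def totalVariationNorm (K : ℝ → ℝ) : ℝ := (eVariationOn K univ).toReal

/-- `K` is a non-negative, bounded function of bounded variation on `ℝ`, left continuous or right
continuous, with support contained in `[-T, T]`. -/
structure IsKernel (K : ℝ → ℝ) (T : ℝ) : Prop where
  nonneg : ∀ x, 0 ≤ K x
  left_or_right_continuous :
    (∀ x, ContinuousWithinAt K (Iic x) x) ∨ (∀ x, ContinuousWithinAt K (Ici x) x)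
  bounded : ∃ M : ℝ, ∀ x, K x ≤ M
  support_subset : Function.support K ⊆ Icc (-T) T
  boundedVariation : BoundedVariationOn K univ

/-- `f` is a bounded probability density on the real line. -/
structure IsBoundedDensity (f : ℝ → ℝ) : Prop where
  measurable : Measurable f
  nonneg : ∀ x, 0 ≤ f x
  bounded : ∃ M : ℝ, ∀ x, f x ≤ M
  integrable : Integrable f volume
  integral_eq_one : ∫ x, f x = 1

/-- The function `x ↦ K((t - x) f(x)^{1/2} / h) f(x)^{1/2} I(|t - x| < h B)`. -/
noncomputable def kernelFun (K f : ℝ → ℝ) (B t h : ℝ) : ℝ → ℝ := fun x =>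
  K ((t - x) / h * √(f x)) * √(f x) * indicator {y : ℝ | |t - y| < h * B} (fun _ => (1 : ℝ)) x

/-- The class of all functions `kernelFun K f B t h` with `t ∈ ℝ` and `h > 0`. -/
def kernelClass (K f : ℝ → ℝ) (B : ℝ) : Set (ℝ → ℝ) :=
  {φ | ∃ t h : ℝ, 0 < h ∧ φ = kernelFun K f B t h}

/-- The covering number `N(F, L₂(Q), ε)`: the smallest number of closed `L₂(Q)`-balls of radius `ε`
(with arbitrary centres in `L₂(Q)`) that cover the class `F` of functions; `⊤` if there is no
finite cover. It is used for classes of bounded measurable functions, all of which have a class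
in `L₂(Q)`. -/
noncomputable def l2CoveringNumber {S : Type*} [MeasurableSpace S] (F : Set (S → ℝ))
    (Q : Measure S) (ε : ℝ) : ℕ∞ :=
  Metric.externalCoveringNumber ε.toNNReal {g : Lp ℝ 2 Q | ∃ φ ∈ F, ⇑g =ᵐ[Q] φ}

/-- `F` is a class of uniformly bounded measurable functions which is of VC type with respect to
the envelope `G`, with characteristics `A` and `v`:
`N(F, L₂(Q), ε) ≤ (A ‖G‖_{L₂(Q)} / ε)^v` for all probability measures `Q` and
`0 < ε ≤ ‖G‖_{L₂(Q)}`. -/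
structure IsVCType {S : Type*} [MeasurableSpace S] (F : Set (S → ℝ)) (G : S → ℝ) (A v : ℝ) :
    Prop where
  pos_A : 0 < A
  pos_v : 0 < v
  measurable : ∀ φ ∈ F, Measurable φ
  bounded : ∃ M : ℝ, ∀ φ ∈ F, ∀ x, |φ x| ≤ M
  measurable_envelope : Measurable G
  envelope : ∀ φ ∈ F, ∀ x, |φ x| ≤ G x
  covering : ∀ (Q : Measure S) [IsProbabilityMeasure Q] (ε : ℝ), 0 < ε →
    ENNReal.ofReal ε ≤ eLpNorm G 2 Q →
    (l2CoveringNumber F Q ε : ℝ≥0∞) ≤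
      (ENNReal.ofReal A * eLpNorm G 2 Q / ENNReal.ofReal ε) ^ v

/-!
The functions of the class depend on the two parameters `(t, h)` only, and the covering number is
bounded by the largest number `m` of functions at mutual `L₂(Q)` distance more than `ε`. Write `V`
for the total variation of `K`, `W = V √‖f‖_∞`, and let `v u` be the variation of `K` on
`(-∞, u]`, so that `v` is monotone with values in `[0, V]` and `|K a - K b| ≤ |v a - v b|`.

Fix a point `x`. If exactly one of two functions has `x` in its window `|t - x| < h B`, they are
told apart by the window. Otherwise their values at `x` differ by at most
`|v u - v u'| √(f x)`, where `u`, `u'` are the arguments of `K`, and a uniform random level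
`s ∈ [0, V)` separates `v u` from `v u'` with probability `|v u - v u'| / V`
(`exists_level_sum_abs_sub_le`). Either way the probability of separation is at least the squared
difference at `x` divided by `W²`. Averaging over `x` and `s`, any set of pairs of `ε`-separated
functions admits a pair `(x, s)` that separates at least the fraction `q = ε² / W²` of the set.
Choosing such `(x, s)` greedily for the pairs that remain
(`exists_finset_card_unseparated_le`), about `2 log m / q` rounds separate all pairs.

On a finite family, the conditions `|t - x| < h B` and `s < v ((t - x) / h * √(f x))` say that three
linear functionals are positive at `(t, h, 1)` (`exists_halfspaces_sum_sq_sub_le`); for the second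
condition this uses that `v` is monotone. Half-spaces of `ℝ³` through the origin have VC dimension
at most `3`, so by the Sauer–Shelah lemma (`card_image_positivePattern_le`) the `m` functions, all
separated by `3 n` half-spaces with `n` about `2 log m / q`, number at most `(3 n + 1)³`. Absorbing
the logarithm gives `m ≤ (40 / q)⁶ ≤ (7 W / ε)¹²`, and `7 W / ε ≥ 1` allows the exponent `22`.
-/

/-! ### Sign patterns of finitely many vectors -/

/-- The vectors of `Z` on which the linear functional `w ↦ w ⬝ᵥ p` is positive. -/
noncomputable def positivePattern {d : ℕ} (Z : Finset (Fin d → ℝ)) (p : Fin d → ℝ) :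
    Finset (Fin d → ℝ) :=
  Z.filter fun w => 0 < w ⬝ᵥ p

open Classical in
/-- Half-spaces through the origin of `ℝ^d` have VC dimension at most `d`. -/
lemma card_le_of_shatters_positivePattern {d : ℕ} {𝒜 : Finset (Finset (Fin d → ℝ))}
    {Z : Finset (Fin d → ℝ)} (h𝒜 : ∀ A ∈ 𝒜, ∃ p, A = positivePattern Z p)
    {s : Finset (Fin d → ℝ)} (hs : 𝒜.Shatters s) : s.card ≤ d := by
  by_contra! hcard
  have hsZ : s ⊆ Z := by
    obtain ⟨A, hA, hsA⟩ := hs.exists_superset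
    obtain ⟨p, rfl⟩ := h𝒜 A hA
    exact hsA.trans (Finset.filter_subset _ _)
  obtain ⟨g, hg, x, hx, hgx⟩ := Module.exists_nontrivial_relation_of_finrank_lt_card
    (R := ℝ) (t := s) (by simpa using hcard)
  -- A half-space selecting the vectors with positive coefficient makes every term of the
  -- relation nonnegative, so the coefficients cannot have a positive entry.
  have key : ∀ g : (Fin d → ℝ) → ℝ, ∑ w ∈ s, g w • w = 0 → ∀ x ∈ s, ¬ 0 < g x := by
    intro g hg x hx hgx
    obtain ⟨A, hA, hsA⟩ := hs (Finset.filter_subset (fun w => 0 < g w) s)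
    obtain ⟨p, rfl⟩ := h𝒜 A hA
    have hiff : ∀ w ∈ s, (0 < w ⬝ᵥ p ↔ 0 < g w) := by
      intro w hw
      have := congrArg (w ∈ ·) hsA
      simpa [positivePattern, hw, hsZ hw] using this
    have hsum : ∑ w ∈ s, g w * (w ⬝ᵥ p) = 0 := by
      have := congrArg (· ⬝ᵥ p) hg
      simpa [sum_dotProduct, smul_dotProduct] using this
    have hpos : 0 < ∑ w ∈ s, g w * (w ⬝ᵥ p) := by
      refine Finset.sum_pos' (fun w hw => ?_) ⟨x, hx, mul_pos hgx ((hiff x hx).2 hgx)⟩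
      by_cases hw' : 0 < g w
      · exact (mul_pos hw' ((hiff w hw).2 hw')).le
      · exact mul_nonneg_of_nonpos_of_nonpos (not_lt.1 hw') (not_lt.1 fun h => hw' ((hiff w hw).1 h))
    exact hpos.ne' hsum
  rcases lt_or_gt_of_ne hgx with hneg | hpos
  · exact key (fun w => -g w) (by simpa using hg) x hx (by simpa using hneg)
  · exact key g hg x hx hpos

lemma sum_choose_le_succ_pow (N d : ℕ) :
    ∑ k ∈ Finset.range (d + 1), N.choose k ≤ (N + 1) ^ d := by
  rw [add_pow]
  refine Finset.sum_le_sum fun k hk => ?_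
  have hk' : 0 < d.choose k := Nat.choose_pos (by simpa [Nat.lt_succ_iff] using hk)
  simpa using (Nat.choose_le_pow N k).trans (Nat.le_mul_of_pos_right _ hk')

open Classical in
/-- The Sauer–Shelah bound for sign patterns: `N` vectors of `ℝ^d` have at most `(N + 1)^d`
positive patterns. -/
lemma card_image_positivePattern_le {ι : Type*} {d : ℕ} (J : Finset ι) (p : ι → Fin d → ℝ)
    (Z : Finset (Fin d → ℝ)) :
    (J.image fun i => positivePattern Z (p i)).card ≤ (Z.card + 1) ^ d := by
  set 𝒜 := J.image fun i => positivePattern Z (p i) with h𝒜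
  have hmem : ∀ A ∈ 𝒜, ∃ p, A = positivePattern Z p := by
    intro A hA
    obtain ⟨i, -, rfl⟩ := Finset.mem_image.1 hA
    exact ⟨p i, rfl⟩
  have hsub : 𝒜.shatterer ⊆ (Finset.range (d + 1)).biUnion fun k => Z.powersetCard k := by
    intro s hs
    have hs' := Finset.mem_shatterer.1 hs
    obtain ⟨A, hA, hsA⟩ := hs'.exists_superset
    obtain ⟨q, rfl⟩ := hmem A hA
    simp only [Finset.mem_biUnion, Finset.mem_range, Finset.mem_powersetCard]
    exact ⟨s.card, Nat.lt_succ_of_le (card_le_of_shatters_positivePattern hmem hs'),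
      hsA.trans (Finset.filter_subset _ _), rfl⟩
  calc 𝒜.card ≤ 𝒜.shatterer.card := 𝒜.card_le_card_shatterer
    _ ≤ _ := Finset.card_le_card hsub
    _ ≤ ∑ k ∈ Finset.range (d + 1), (Z.powersetCard k).card := Finset.card_biUnion_le
    _ = ∑ k ∈ Finset.range (d + 1), Z.card.choose k := by simp
    _ ≤ _ := sum_choose_le_succ_pow _ _

/-! ### Greedy choice of separating tests -/

open Classical in
/-- If among any subfamily of `P` some `r` tests separate at least the fraction `q`, then `r * n`
tests leave at most the fraction `(1 - q) ^ n` of `P` unseparated. -/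
lemma exists_finset_card_unseparated_le {ι Ω : Type*} (sep : Ω → ι → Prop) (P : Finset ι) {q : ℝ}
    (hq : q ≤ 1) {r : ℕ}
    (h : ∀ P' ⊆ P, ∃ T : Finset Ω, T.card ≤ r ∧
      q * P'.card ≤ (P'.filter fun i => ∃ z ∈ T, sep z i).card) (n : ℕ) :
    ∃ Z : Finset Ω, Z.card ≤ r * n ∧
      ((P.filter fun i => ∀ z ∈ Z, ¬ sep z i).card : ℝ) ≤ (1 - q) ^ n * P.card := by
  induction n with
  | zero => exact ⟨∅, by simp⟩
  | succ n ih =>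
    obtain ⟨Z, hZ, hle⟩ := ih
    set P' := P.filter fun i => ∀ z ∈ Z, ¬ sep z i with hP'
    obtain ⟨T, hT, hTle⟩ := h P' (Finset.filter_subset _ _)
    refine ⟨Z ∪ T, (Finset.card_union_le _ _).trans (by rw [Nat.mul_succ]; omega), ?_⟩
    have hrest : (P.filter fun i => ∀ z ∈ Z ∪ T, ¬ sep z i)
        = P'.filter fun i => ¬ ∃ z ∈ T, sep z i := by
      ext i
      simp only [hP', Finset.mem_filter, Finset.mem_union, or_imp, forall_and, not_exists, not_and,
        and_assoc]
    have hadd := Finset.card_filter_add_card_filter_not (s := P') (fun i => ∃ z ∈ T, sep z i)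
    rw [hrest]
    have hadd' : ((P'.filter fun i => ∃ z ∈ T, sep z i).card : ℝ)
        + (P'.filter fun i => ¬ ∃ z ∈ T, sep z i).card = P'.card := by exact_mod_cast hadd
    calc ((P'.filter fun i => ¬ ∃ z ∈ T, sep z i).card : ℝ) ≤ (1 - q) * P'.card := by linarith
      _ ≤ (1 - q) * ((1 - q) ^ n * P.card) := by gcongr
      _ = (1 - q) ^ (n + 1) * P.card := by ring

open Classical in
/-- If any set of pairs from a family of `m` points of `ℝ^3` can be separated up to the fraction
`1 - q` by three half-spaces, then `m` is at most of order `q ^ (-6)`. -/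
lemma card_le_of_separating_halfspaces {ι : Type*} (J : Finset ι) (p : ι → Fin 3 → ℝ) {q : ℝ}
    (hq0 : 0 < q) (hq1 : q ≤ 1)
    (h : ∀ P ⊆ J.offDiag, ∃ T : Finset (Fin 3 → ℝ), T.card ≤ 3 ∧
      q * P.card ≤ (P.filter fun ij => ∃ w ∈ T, ¬ (0 < w ⬝ᵥ p ij.1 ↔ 0 < w ⬝ᵥ p ij.2)).card) :
    (J.card : ℝ) ≤ (40 / q) ^ 6 := by
  rcases J.eq_empty_or_nonempty with rfl | hJ
  · simp; positivity
  have hm : (1 : ℝ) ≤ J.card := by exact_mod_cast hJ.card_pos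
  set m : ℝ := (J.card : ℝ) with hmdef
  -- After `n` rounds fewer than `m ^ 2 * exp (-q * n) < 1` pairs remain.
  set n := ⌊2 * Real.log m / q⌋₊ + 1 with hn
  have hlog : 0 ≤ Real.log m := Real.log_nonneg hm
  have hn1 : 2 * Real.log m / q < n := by
    rw [hn]; push_cast; exact Nat.lt_floor_add_one _
  have hn2 : (n : ℝ) ≤ 2 * Real.log m / q + 1 := by
    rw [hn]; push_cast
    gcongr
    exact Nat.floor_le (by positivity)
  obtain ⟨Z, hZ, hrest⟩ := exists_finset_card_unseparated_le
    (fun (w : Fin 3 → ℝ) (ij : ι × ι) => ¬ (0 < w ⬝ᵥ p ij.1 ↔ 0 < w ⬝ᵥ p ij.2)) J.offDiag hq1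
    (fun P hP => by convert h P hP) n
  have hlt : (1 - q) ^ n * (J.offDiag.card : ℝ) < 1 := by
    have h1 : (1 - q) ^ n ≤ Real.exp (-(q * n)) := by
      calc (1 - q) ^ n ≤ Real.exp (-q) ^ n := by
            have : 0 ≤ 1 - q := by linarith
            gcongr
            exact Real.one_sub_le_exp_neg q
        _ = Real.exp (-(q * n)) := by rw [← Real.exp_nat_mul]; ring_nf
    have h2 : (J.offDiag.card : ℝ) ≤ m ^ 2 := by
      rw [Finset.offDiag_card, hmdef, sq]
      exact_mod_cast Nat.sub_le _ _
    have h3 : m ^ 2 = Real.exp (2 * Real.log m) := by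
      rw [two_mul, Real.exp_add, Real.exp_log (by linarith), sq]
    calc _ ≤ Real.exp (-(q * n)) * m ^ 2 := by gcongr
      _ = Real.exp (2 * Real.log m - q * n) := by rw [h3, ← Real.exp_add]; ring_nf
      _ < 1 := by
        rw [Real.exp_lt_one_iff]
        rw [div_lt_iff₀ hq0] at hn1
        linarith
  have hnone : (J.offDiag.filter fun ij => ∀ w ∈ Z,
      ¬ ¬ (0 < w ⬝ᵥ p ij.1 ↔ 0 < w ⬝ᵥ p ij.2)) = ∅ := by
    rw [← Finset.card_eq_zero]
    have := hrest.trans_lt hlt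
    exact_mod_cast Nat.lt_one_iff.1 (by exact_mod_cast this)
  have hinj : Set.InjOn (fun i => positivePattern Z (p i)) J := by
    intro i hi j hj hij
    by_contra hne
    have hmem : (i, j) ∈ J.offDiag := Finset.mem_offDiag.2 ⟨hi, hj, hne⟩
    refine Finset.notMem_empty (i, j) (hnone ▸ Finset.mem_filter.2 ⟨hmem, fun w hw => ?_⟩)
    have := congrArg (w ∈ ·) hij
    simpa [positivePattern, hw] using this
  have hcard : J.card ≤ (3 * n + 1) ^ 3 := by
    rw [← Finset.card_image_of_injOn hinj]
    exact (card_image_positivePattern_le J p Z).trans (by gcongr)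
  -- The logarithm in `n` is absorbed by `log m ≤ 6 * m ^ (1 / 6)`.
  set y : ℝ := m ^ (1 / 6 : ℝ) with hy
  have hy6 : y ^ 6 = m := by
    rw [hy, ← Real.rpow_natCast, ← Real.rpow_mul (by linarith)]; norm_num
  have hy1 : 1 ≤ y := Real.one_le_rpow hm (by norm_num)
  have hlogy : Real.log m ≤ 6 * y := by
    rw [← hy6, Real.log_pow]
    have := Real.log_le_sub_one_of_pos (show 0 < y by linarith)
    push_cast; linarith
  have hn3 : (3 * n + 1 : ℝ) ≤ 40 * y / q := by
    have : 2 * Real.log m / q + 1 ≤ (12 * y + 1) / q := by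
      rw [div_add' _ _ _ hq0.ne']
      exact div_le_div_of_nonneg_right (by linarith) hq0.le
    have h1 : (1 : ℝ) ≤ 1 / q := by rw [le_div_iff₀ hq0]; linarith
    have h2 : (3 * n + 1 : ℝ) ≤ 3 * ((12 * y + 1) / q) + 1 / q := by linarith
    refine h2.trans ?_
    rw [← mul_div_assoc, ← add_div]
    gcongr
    linarith
  have hcard' : y ^ 6 ≤ (40 * y / q) ^ 3 := by
    rw [hy6]
    calc m ≤ (3 * n + 1 : ℝ) ^ 3 := by rw [hmdef]; exact_mod_cast hcard
      _ ≤ _ := by gcongr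
  have hy3 : y ^ 3 ≤ (40 / q) ^ 3 := by
    have hpos : 0 < y ^ 3 := by positivity
    refine le_of_mul_le_mul_right ?_ hpos
    calc y ^ 3 * y ^ 3 = y ^ 6 := by ring
      _ ≤ _ := hcard'
      _ = _ := by ring
  calc m = y ^ 3 * y ^ 3 := by rw [← hy6]; ring
    _ ≤ (40 / q) ^ 3 * (40 / q) ^ 3 := by gcongr
    _ = _ := by ring

/-! ### Bounded variation -/

/-- The variation of `K` on `(-∞, u]`, as a function of `u`. -/
noncomputable def variationBelow (K : ℝ → ℝ) (u : ℝ) : ℝ := (eVariationOn K (Iic u)).toReal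

section Variation

variable {K : ℝ → ℝ} (hK : BoundedVariationOn K univ)
include hK

lemma monotone_variationBelow : Monotone (variationBelow K) := fun _ _ h =>
  ENNReal.toReal_mono (hK.mono (subset_univ _)) (eVariationOn.mono K (Iic_subset_Iic.2 h))

lemma variationBelow_le (u : ℝ) : variationBelow K u ≤ totalVariationNorm K :=
  ENNReal.toReal_mono hK (eVariationOn.mono K (subset_univ _))

lemma abs_sub_le_variationBelow (a b : ℝ) :
    |K a - K b| ≤ |variationBelow K a - variationBelow K b| := by
  wlog hab : a ≤ b generalizing a b
  · rw [abs_sub_comm, abs_sub_comm (variationBelow K a)]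
    exact this b a (le_of_not_ge hab)
  have hmono := monotone_variationBelow hK hab
  have hadd : eVariationOn K (Iic a) + eVariationOn K (Icc a b) ≤ eVariationOn K (Iic b) :=
    (eVariationOn.add_le_union K fun x hx y hy => le_trans hx hy.1).trans
      (eVariationOn.mono K (union_subset (Iic_subset_Iic.2 hab) Icc_subset_Iic_self))
  have hne : ∀ s, eVariationOn K s ≠ ∞ := fun s => hK.mono (subset_univ s)
  have h1 : |K a - K b| ≤ (eVariationOn K (Icc a b)).toReal := by
    rw [← Real.dist_eq]
    exact BoundedVariationOn.dist_le (hne _) (left_mem_Icc.2 hab) (right_mem_Icc.2 hab)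
  have h2 := ENNReal.toReal_mono (hne _) hadd
  rw [ENNReal.toReal_add (hne _) (hne _)] at h2
  rw [abs_sub_comm (variationBelow K a), abs_of_nonneg (sub_nonneg.2 hmono)]
  unfold variationBelow
  linarith

lemma measurable_of_boundedVariationOn : Measurable K := by
  obtain ⟨p, q, hp, hq, hpq⟩ := hK.locallyBoundedVariationOn.exists_monotoneOn_sub_monotoneOn
  rw [hpq]
  exact (monotoneOn_univ.1 hp).measurable.sub (monotoneOn_univ.1 hq).measurable

end Variation

lemma IsKernel.le_totalVariationNorm {K : ℝ → ℝ} {T : ℝ} (hK : IsKernel K T) (u : ℝ) :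
    K u ≤ totalVariationNorm K := by
  have h0 : K (T + 1) = 0 := by
    by_contra h
    have := (hK.support_subset h).2
    linarith
  have := hK.boundedVariation.dist_le (mem_univ u) (mem_univ (T + 1))
  rw [Real.dist_eq, h0, sub_zero] at this
  exact (le_abs_self _).trans this

lemma totalVariationNorm_nonneg (K : ℝ → ℝ) : 0 ≤ totalVariationNorm K := ENNReal.toReal_nonneg

lemma IsBoundedDensity.le_supNorm {f : ℝ → ℝ} (hf : IsBoundedDensity f) (x : ℝ) :
    f x ≤ supNorm f := by
  obtain ⟨M, hM⟩ := hf.bounded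
  refine (le_abs_self _).trans (le_ciSup (f := fun x => |f x|) ⟨M, ?_⟩ x)
  rintro _ ⟨y, rfl⟩
  simpa [abs_of_nonneg (hf.nonneg y)] using hM y

/-! ### The functions of the class -/

lemma measurable_kernelFun {K f : ℝ → ℝ} (hK : Measurable K) (hf : Measurable f) (B t h : ℝ) :
    Measurable (kernelFun K f B t h) := by
  unfold kernelFun
  refine Measurable.mul (by fun_prop) (measurable_const.indicator ?_)
  exact measurableSet_lt (by fun_prop) measurable_const

lemma kernelFun_of_lt {K f : ℝ → ℝ} {B t h x : ℝ} (hx : |t - x| < h * B) :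
    kernelFun K f B t h x = K ((t - x) / h * √(f x)) * √(f x) := by
  simp [kernelFun, hx]

lemma kernelFun_of_not_lt {K f : ℝ → ℝ} {B t h x : ℝ} (hx : ¬ |t - x| < h * B) :
    kernelFun K f B t h x = 0 := by
  simp [kernelFun, hx]

lemma kernelFun_mem_Icc {K f : ℝ → ℝ} {T : ℝ} (hK : IsKernel K T) (hf : IsBoundedDensity f)
    (B t h x : ℝ) :
    kernelFun K f B t h x ∈ Icc 0 (totalVariationNorm K * √(supNorm f)) := by
  have hV := totalVariationNorm_nonneg K
  by_cases hx : |t - x| < h * B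
  · rw [kernelFun_of_lt hx]
    exact ⟨mul_nonneg (hK.nonneg _) (Real.sqrt_nonneg _), mul_le_mul (hK.le_totalVariationNorm _)
      (Real.sqrt_le_sqrt (hf.le_supNorm x)) (Real.sqrt_nonneg _) hV⟩
  · rw [kernelFun_of_not_lt hx]
    exact ⟨le_rfl, by positivity⟩

/-! ### Separating pairs of functions by half-spaces -/

/-- Among finitely many pairs of points of `[0, V]`, a level chosen uniformly at random in `[0, V)`
separates on average the fraction `|a i - b i| / V`. -/
lemma exists_level_sum_abs_sub_le {ι : Type*} (P : Finset ι) (a b : ι → ℝ) {V : ℝ} (hV : 0 < V)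
    (ha : ∀ i ∈ P, a i ∈ Icc 0 V) (hb : ∀ i ∈ P, b i ∈ Icc 0 V) :
    ∃ s, ∑ i ∈ P, |a i - b i| ≤ V * (P.filter fun i => ¬ (s < a i ↔ s < b i)).card := by
  classical
  let g : ℝ → ℝ := fun s => ∑ i ∈ P, (Ico (min (a i) (b i)) (max (a i) (b i))).indicator 1 s
  have hint : ∀ i ∈ P, IntegrableOn
      ((Ico (min (a i) (b i)) (max (a i) (b i))).indicator (1 : ℝ → ℝ)) (Ico 0 V) := by
    intro i _
    exact (integrableOn_const (by simp)).indicator measurableSet_Ico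
  have hvol : (volume (Ico 0 V)) ≠ 0 := by simp [hV]
  obtain ⟨s, -, hs⟩ := exists_setAverage_le (f := g) hvol (by simp)
    (integrable_finsetSum P hint)
  refine ⟨s, ?_⟩
  have hg : g s = ((P.filter fun i => ¬ (s < a i ↔ s < b i)).card : ℝ) := by
    simp only [g, Finset.card_filter, Nat.cast_sum]
    refine Finset.sum_congr rfl fun i _ => ?_
    simp only [indicator_apply, mem_Ico, min_le_iff, lt_max_iff, Pi.one_apply, Nat.cast_ite,
      Nat.cast_one, Nat.cast_zero]
    congr 1
    grind
  have hintegral : ∫ s in Ico 0 V, g s = ∑ i ∈ P, |a i - b i| := by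
    rw [integral_finsetSum P hint]
    refine Finset.sum_congr rfl fun i hi => ?_
    have hsub : Ico (min (a i) (b i)) (max (a i) (b i)) ⊆ Ico 0 V :=
      Ico_subset_Ico (le_min (ha i hi).1 (hb i hi).1) (max_le (ha i hi).2 (hb i hi).2)
    rw [setIntegral_indicator measurableSet_Ico, inter_eq_self_of_subset_right hsub]
    simp [max_sub_min_eq_abs, abs_sub_comm]
  rwa [setAverage_eq, hintegral, Real.volume_real_Ico_of_le hV.le, hg, smul_eq_mul, sub_zero,
    inv_mul_le_iff₀ hV] at hs

lemma exists_lt_iff_lt_of_monotone {v : ℝ → ℝ} (hv : Monotone v) (S : Finset ℝ) (s : ℝ) :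
    ∃ c, ∀ u ∈ S, s < v u ↔ c < u := by
  by_cases hne : (S.filter fun u => v u ≤ s).Nonempty
  · refine ⟨(S.filter fun u => v u ≤ s).max' hne, fun u hu => ⟨fun h => ?_, fun h => ?_⟩⟩
    · by_contra! hle
      have := (Finset.mem_filter.1 (Finset.max'_mem _ hne)).2
      exact absurd (hv hle) (not_le.2 (this.trans_lt h))
    · by_contra! hle
      exact absurd (Finset.le_max' _ u (Finset.mem_filter.2 ⟨hu, hle⟩)) (not_le.2 h)
  · obtain ⟨c, hc⟩ := S.bddBelow
    refine ⟨c - 1, fun u hu => ⟨fun _ => by have := hc hu; linarith, fun _ => ?_⟩⟩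
    by_contra! hle
    exact hne ⟨u, Finset.mem_filter.2 ⟨hu, hle⟩⟩

open Classical in
/-- At a point `x`, three half-spaces in the parameters `(t, h, 1)` separate a number of pairs
controlled by the squared differences of the corresponding functions at `x`. Two half-spaces
describe the condition `|t - x| < h * B`; the third one says that the variation function of `K`
at `(t - x) / h * √(f x)` exceeds a suitable level. -/
lemma exists_halfspaces_sum_sq_sub_le {K f : ℝ → ℝ} {T : ℝ} (hK : IsKernel K T)
    (hf : IsBoundedDensity f) (hV : 0 < totalVariationNorm K) (B x : ℝ) {ι : Type*} (t h : ι → ℝ)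
    (P : Finset (ι × ι)) (hP : ∀ ij ∈ P, 0 < h ij.1 ∧ 0 < h ij.2) :
    ∃ W : Finset (Fin 3 → ℝ), W.card ≤ 3 ∧
      ∑ ij ∈ P, (kernelFun K f B (t ij.1) (h ij.1) x - kernelFun K f B (t ij.2) (h ij.2) x) ^ 2 ≤
        (totalVariationNorm K * √(supNorm f)) ^ 2 * (P.filter fun ij => ∃ w ∈ W,
          ¬ (0 < w ⬝ᵥ ![t ij.1, h ij.1, 1] ↔ 0 < w ⬝ᵥ ![t ij.2, h ij.2, 1])).card := by
  set V := totalVariationNorm K with hVdef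
  set M := supNorm f with hM
  have hfM : f x ≤ M := hf.le_supNorm x
  have hf0 := hf.nonneg x
  let v := variationBelow K
  have hvmono : Monotone v := monotone_variationBelow hK.boundedVariation
  have hv : ∀ u, v u ∈ Icc 0 V := fun u =>
    ⟨ENNReal.toReal_nonneg, variationBelow_le hK.boundedVariation u⟩
  let u : ι → ℝ := fun i => (t i - x) / h i * √(f x)
  let inside : ι → Prop := fun i => |t i - x| < h i * B
  -- Pairs of which only one member lives at `x` get the values `V` and `0`, which every level
  -- separates.
  let a : ι × ι → ℝ := fun ij => if inside ij.1 ↔ inside ij.2 then v (u ij.1) else V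
  let b : ι × ι → ℝ := fun ij => if inside ij.1 ↔ inside ij.2 then v (u ij.2) else 0
  have ha : ∀ ij ∈ P, a ij ∈ Icc 0 V := by
    intro ij _
    simp only [a]
    split_ifs
    · exact hv _
    · exact ⟨hV.le, le_rfl⟩
  have hb : ∀ ij ∈ P, b ij ∈ Icc 0 V := by
    intro ij _
    simp only [b]
    split_ifs
    · exact hv _
    · exact ⟨le_rfl, hV.le⟩
  obtain ⟨s, hs⟩ := exists_level_sum_abs_sub_le P a b hV ha hb
  obtain ⟨c, hc⟩ := exists_lt_iff_lt_of_monotone hvmono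
    (P.image (fun ij => u ij.1) ∪ P.image (fun ij => u ij.2)) s
  let w₀ : Fin 3 → ℝ := ![√(f x), -c, -(√(f x) * x)]
  let w₁ : Fin 3 → ℝ := ![1, B, -x]
  let w₂ : Fin 3 → ℝ := ![-1, B, x]
  have hw₀ : ∀ i, 0 < h i → (0 < w₀ ⬝ᵥ ![t i, h i, 1] ↔ c < u i) := by
    intro i hi
    have : c < u i ↔ c * h i < (t i - x) * √(f x) := by
      simp only [u]; rw [div_mul_eq_mul_div, lt_div_iff₀ hi]
    have hdot : w₀ ⬝ᵥ ![t i, h i, 1] = (t i - x) * √(f x) - c * h i := by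
      simp only [w₀, Matrix.vec3_dotProduct']
      ring
    rw [this, hdot, sub_pos]
  have hw₁₂ : ∀ i, inside i ↔ 0 < w₁ ⬝ᵥ ![t i, h i, 1] ∧ 0 < w₂ ⬝ᵥ ![t i, h i, 1] := by
    intro i
    simp only [inside, w₁, w₂, abs_lt, Matrix.vec3_dotProduct']
    constructor
    · rintro ⟨h1, h2⟩
      constructor <;> linarith
    · rintro ⟨h1, h2⟩
      constructor <;> linarith
  refine ⟨{w₀, w₁, w₂}, Finset.card_le_three, ?_⟩
  have hpoint : ∀ ij ∈ P,
      (kernelFun K f B (t ij.1) (h ij.1) x - kernelFun K f B (t ij.2) (h ij.2) x) ^ 2 ≤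
        V * M * |a ij - b ij| := by
    intro ij hij
    have hM0 : 0 ≤ M := hf0.trans hfM
    by_cases hiff : inside ij.1 ↔ inside ij.2
    · simp only [a, b, if_pos hiff]
      by_cases h1 : inside ij.1
      · rw [kernelFun_of_lt h1, kernelFun_of_lt (hiff.1 h1), ← sub_mul, mul_pow, Real.sq_sqrt hf0,
          ← sq_abs]
        have hle : |K (u ij.1) - K (u ij.2)| ≤ |v (u ij.1) - v (u ij.2)| :=
          abs_sub_le_variationBelow hK.boundedVariation _ _
        have hle' : |v (u ij.1) - v (u ij.2)| ≤ V := by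
          rw [abs_le]
          constructor <;> linarith [(hv (u ij.1)).1, (hv (u ij.1)).2, (hv (u ij.2)).1,
            (hv (u ij.2)).2]
        calc |K (u ij.1) - K (u ij.2)| ^ 2 * f x
            ≤ (V * |v (u ij.1) - v (u ij.2)|) * M := by
              rw [sq]
              gcongr
              exact hle.trans hle'
          _ = _ := by ring
      · rw [kernelFun_of_not_lt h1, kernelFun_of_not_lt fun h2 => h1 (hiff.2 h2)]
        simp only [sub_self, ne_eq, OfNat.ofNat_ne_zero, not_false_eq_true, zero_pow]
        positivity
    · simp only [a, b, if_neg hiff, sub_zero, abs_of_pos hV]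
      have h1 := kernelFun_mem_Icc hK hf B (t ij.1) (h ij.1) x
      have h2 := kernelFun_mem_Icc hK hf B (t ij.2) (h ij.2) x
      calc _ ≤ (V * √M) ^ 2 := by
            refine sq_le_sq' ?_ ?_ <;> linarith [h1.1, h1.2, h2.1, h2.2]
        _ = V * M * V := by rw [mul_pow, Real.sq_sqrt hM0]; ring
  calc _ ≤ ∑ ij ∈ P, V * M * |a ij - b ij| := Finset.sum_le_sum hpoint
    _ = V * M * ∑ ij ∈ P, |a ij - b ij| := by rw [Finset.mul_sum]
    _ ≤ V * M * (V * (P.filter fun ij => ¬ (s < a ij ↔ s < b ij)).card) := by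
        have : 0 ≤ M := hf0.trans hfM
        gcongr
    _ = (V * √M) ^ 2 * (P.filter fun ij => ¬ (s < a ij ↔ s < b ij)).card := by
        rw [mul_pow, Real.sq_sqrt (hf0.trans hfM)]; ring
    _ ≤ _ := by
        gcongr with ij hij
        intro hsep
        by_cases hiff : inside ij.1 ↔ inside ij.2
        · have h1 : u ij.1 ∈ P.image (fun ij => u ij.1) := Finset.mem_image.2 ⟨ij, hij, rfl⟩
          have h2 : u ij.2 ∈ P.image (fun ij => u ij.2) := Finset.mem_image.2 ⟨ij, hij, rfl⟩
          refine ⟨w₀, by simp, ?_⟩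
          rw [hw₀ _ (hP ij hij).1, hw₀ _ (hP ij hij).2, ← hc _ (Finset.mem_union_left _ h1),
            ← hc _ (Finset.mem_union_right _ h2)]
          simpa only [a, b, if_pos hiff] using hsep
        · by_contra! hall
          refine hiff ?_
          rw [hw₁₂, hw₁₂, hall w₁ (by simp), hall w₂ (by simp)]

/-! ### Packing and covering numbers -/

/-- Bound on the size of an `ε`-separated family. It may be indexed by any type, so that it applies
to a set of elements of `L₂(Q)` with chosen parameters. -/
lemma card_le_of_sq_le_integral_sq_sub {K f : ℝ → ℝ} {T : ℝ} (hK : IsKernel K T)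
    (hf : IsBoundedDensity f) (B : ℝ) (Q : Measure ℝ) [IsProbabilityMeasure Q] {ε : ℝ}
    (hε : 0 < ε) (hεW : ε ≤ 7 * (totalVariationNorm K * √(supNorm f))) {ι : Type*} (J : Finset ι)
    (t h : ι → ℝ) (hh : ∀ i ∈ J, 0 < h i)
    (hsep : ∀ i ∈ J, ∀ j ∈ J, i ≠ j →
      ε ^ 2 ≤ ∫ x, (kernelFun K f B (t i) (h i) x - kernelFun K f B (t j) (h j) x) ^ 2 ∂Q) :
    (J.card : ℝ) ≤ (7 * (totalVariationNorm K * √(supNorm f)) / ε) ^ 12 := by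
  classical
  set W := totalVariationNorm K * √(supNorm f) with hWdef
  have hW : 0 < W := by linarith
  have hV : 0 < totalVariationNorm K :=
    pos_of_mul_pos_left hW (Real.sqrt_nonneg _)
  rcases le_or_gt J.card 1 with hJ | hJ
  · calc (J.card : ℝ) ≤ 1 := by exact_mod_cast hJ
      _ ≤ _ := one_le_pow₀ ((one_le_div hε).2 hεW)
  let F : ι → ℝ → ℝ := fun i => kernelFun K f B (t i) (h i)
  have hF : ∀ i x, F i x ∈ Icc 0 W := fun i x => kernelFun_mem_Icc hK hf B (t i) (h i) x
  have hFsq : ∀ i j x, (F i x - F j x) ^ 2 ≤ W ^ 2 := by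
    intro i j x
    refine sq_le_sq' ?_ ?_ <;> linarith [(hF i x).1, (hF i x).2, (hF j x).1, (hF j x).2]
  have hFmeas : ∀ i, Measurable (F i) := fun i =>
    measurable_kernelFun (measurable_of_boundedVariationOn hK.boundedVariation) hf.measurable _ _ _
  have hint : ∀ i j, Integrable (fun x => (F i x - F j x) ^ 2) Q := fun i j =>
    Integrable.of_bound (((hFmeas i).sub (hFmeas j)).pow_const 2).aestronglyMeasurable (W ^ 2)
      (.of_forall fun x => by rw [Real.norm_of_nonneg (sq_nonneg _)]; exact hFsq i j x)
  have hεW' : ε ^ 2 / W ^ 2 ≤ 1 := by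
    obtain ⟨i, hi, j, hj, hij⟩ := Finset.one_lt_card.1 hJ
    rw [div_le_one (by positivity)]
    calc ε ^ 2 ≤ ∫ x, (F i x - F j x) ^ 2 ∂Q := hsep i hi j hj hij
      _ ≤ ∫ _, W ^ 2 ∂Q := integral_mono (hint i j) (integrable_const _) (hFsq i j)
      _ = W ^ 2 := by simp
  have hcard := card_le_of_separating_halfspaces J (fun i => ![t i, h i, 1])
    (q := ε ^ 2 / W ^ 2) (by positivity) hεW' fun P hP => by
      have hmem : ∀ ij ∈ P, ij.1 ∈ J ∧ ij.2 ∈ J ∧ ij.1 ≠ ij.2 := fun ij hij =>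
        Finset.mem_offDiag.1 (hP hij)
      -- First moment method: some point `x` is at least as good as the average over `Q`.
      obtain ⟨x, hx⟩ := exists_integral_le (μ := Q)
        (f := fun x => ∑ ij ∈ P, (F ij.1 x - F ij.2 x) ^ 2)
        (integrable_finsetSum P fun ij _ => hint ij.1 ij.2)
      rw [integral_finsetSum P fun ij _ => hint ij.1 ij.2] at hx
      have hlow : P.card * ε ^ 2 ≤ ∑ ij ∈ P, ∫ x, (F ij.1 x - F ij.2 x) ^ 2 ∂Q := by
        rw [← nsmul_eq_mul]
        refine Finset.card_nsmul_le_sum P _ _ fun ij hij => ?_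
        obtain ⟨h1, h2, h3⟩ := hmem ij hij
        exact hsep _ h1 _ h2 h3
      obtain ⟨S, hS, hle⟩ := exists_halfspaces_sum_sq_sub_le hK hf hV B x t h P fun ij hij =>
        ⟨hh _ (hmem ij hij).1, hh _ (hmem ij hij).2.1⟩
      refine ⟨S, hS, ?_⟩
      rw [div_mul_eq_mul_div, div_le_iff₀ (by positivity), mul_comm, mul_comm _ (W ^ 2)]
      exact (hlow.trans hx).trans hle
  -- The constant `7` comes from `40 ≤ 7 ^ 2`.
  calc (J.card : ℝ) ≤ (40 / (ε ^ 2 / W ^ 2)) ^ 6 := hcard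
    _ ≤ (49 / (ε ^ 2 / W ^ 2)) ^ 6 := by gcongr; norm_num
    _ = (7 * W / ε) ^ 12 := by field_simp; norm_num

lemma encard_le_floor_of_forall_finset_card_le {α : Type*} {C : Set α} {b : ℝ}
    (h : ∀ J : Finset α, (J : Set α) ⊆ C → (J.card : ℝ) ≤ b) : C.encard ≤ ⌊b⌋₊ := by
  by_contra! hlt
  obtain ⟨D, hDC, hD⟩ := Set.exists_subset_encard_eq (Order.add_one_le_of_lt hlt)
  have hfin : D.Finite := Set.finite_of_encard_eq_coe (k := ⌊b⌋₊ + 1) (by simpa using hD)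
  have hcard : hfin.toFinset.card = ⌊b⌋₊ + 1 := by
    rw [hfin.encard_eq_coe_toFinset_card] at hD
    exact_mod_cast hD
  have := h hfin.toFinset (by simpa using hDC)
  rw [hcard] at this
  push_cast at this
  exact absurd this (not_le.2 (Nat.lt_floor_add_one b))

lemma l2CoveringNumber_kernelClass_le {K f : ℝ → ℝ} {T : ℝ} (hK : IsKernel K T)
    (hf : IsBoundedDensity f) (B : ℝ) (Q : Measure ℝ) [IsProbabilityMeasure Q] {ε : ℝ}
    (hε : 0 < ε) (hεW : ε ≤ 7 * (totalVariationNorm K * √(supNorm f))) :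
    (l2CoveringNumber (kernelClass K f B) Q ε : ℝ≥0∞) ≤
      ENNReal.ofReal ((7 * (totalVariationNorm K * √(supNorm f)) / ε) ^ 22) := by
  set W := totalVariationNorm K * √(supNorm f) with hWdef
  set A : Set (Lp ℝ 2 Q) := {g | ∃ φ ∈ kernelClass K f B, ⇑g =ᵐ[Q] φ} with hA
  have hpack : Metric.packingNumber ε.toNNReal A ≤ ⌊(7 * W / ε) ^ 12⌋₊ := by
    refine iSup₂_le fun C hCA => iSup_le fun hC => ?_
    have hrep : ∀ g : Lp ℝ 2 Q, ∃ p : ℝ × ℝ, g ∈ A →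
        0 < p.2 ∧ ⇑g =ᵐ[Q] kernelFun K f B p.1 p.2 := by
      intro g
      by_cases hg : g ∈ A
      · obtain ⟨_, ⟨t, h, hh, rfl⟩, hgφ⟩ := hg
        exact ⟨(t, h), fun _ => ⟨hh, hgφ⟩⟩
      · exact ⟨0, fun h => absurd h hg⟩
    choose p hp using hrep
    refine encard_le_floor_of_forall_finset_card_le fun J hJ => ?_
    refine card_le_of_sq_le_integral_sq_sub hK hf B Q hε hεW J (fun g => (p g).1)
      (fun g => (p g).2) (fun g hg => (hp g (hCA (hJ hg))).1) fun g hg g' hg' hne => ?_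
    have hlt : (ε.toNNReal : ℝ≥0∞) < edist g g' := hC (hJ hg) (hJ hg') hne
    have hae : ⇑(g - g') =ᵐ[Q] fun x => kernelFun K f B (p g).1 (p g).2 x -
        kernelFun K f B (p g').1 (p g').2 x := by
      filter_upwards [Lp.coeFn_sub g g', (hp g (hCA (hJ hg))).2, (hp g' (hCA (hJ hg'))).2]
        with x h1 h2 h3
      rw [h1, Pi.sub_apply, h2, h3]
    have hlt' : ε < ‖g - g'‖ := by
      rw [edist_dist, dist_eq_norm] at hlt
      exact (ENNReal.ofReal_lt_ofReal_iff_of_nonneg hε.le).1 hlt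
    calc ε ^ 2 ≤ ‖g - g'‖ ^ 2 := by gcongr
      _ = ∫ x, ((g - g' : Lp ℝ 2 Q) x) ^ 2 ∂Q := by
        rw [← real_inner_self_eq_norm_sq, L2.inner_def]
        simp [sq]
      _ = _ := integral_congr_ae (by filter_upwards [hae] with x hx; rw [hx])
  calc (l2CoveringNumber (kernelClass K f B) Q ε : ℝ≥0∞)
      ≤ (Metric.packingNumber ε.toNNReal A : ℝ≥0∞) := by
        exact_mod_cast (Metric.externalCoveringNumber_le_coveringNumber _ A).trans
          (Metric.coveringNumber_le_packingNumber _ A)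
    _ ≤ ((⌊(7 * W / ε) ^ 12⌋₊ : ℕ∞) : ℝ≥0∞) := by exact_mod_cast hpack
    _ = ENNReal.ofReal (⌊(7 * W / ε) ^ 12⌋₊ : ℝ) := by simp
    _ ≤ ENNReal.ofReal ((7 * W / ε) ^ 12) :=
        ENNReal.ofReal_le_ofReal (Nat.floor_le (by positivity))
    _ ≤ _ := ENNReal.ofReal_le_ofReal (pow_le_pow_right₀ ((one_le_div hε).2 hεW) (by norm_num))

theorem lemma4 :
    ∃ R : ℝ, 1 ≤ R ∧ ∀ (K f : ℝ → ℝ) (T B : ℝ), IsKernel K T → IsBoundedDensity f → 0 < B →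
      (∀ (Q : Measure ℝ) [IsProbabilityMeasure Q] (ε : ℝ), 0 < ε →
        ε ≤ R * totalVariationNorm K * √(supNorm f) →
        (l2CoveringNumber (kernelClass K f B) Q ε : ℝ≥0∞) ≤
          ENNReal.ofReal ((R * totalVariationNorm K * √(supNorm f) / ε) ^ 22)) ∧
      IsVCType (kernelClass K f B) (fun _ => totalVariationNorm K * √(supNorm f)) R 22 := by
  refine ⟨7, by norm_num, fun K f T B hK hf _ => ?_⟩
  have hbound : ∀ φ ∈ kernelClass K f B, ∀ x,
      |φ x| ≤ totalVariationNorm K * √(supNorm f) := by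
    rintro _ ⟨t, h, -, rfl⟩ x
    have := kernelFun_mem_Icc hK hf B t h x
    rw [abs_of_nonneg this.1]
    exact this.2
  have hW0 : 0 ≤ totalVariationNorm K * √(supNorm f) :=
    mul_nonneg (totalVariationNorm_nonneg K) (Real.sqrt_nonneg _)
  refine ⟨fun Q _ ε hε hεW => ?_, by norm_num, by norm_num, ?_, ⟨_, hbound⟩, measurable_const,
    hbound, fun Q _ ε hε hεW => ?_⟩
  · rw [mul_assoc] at hεW ⊢
    exact l2CoveringNumber_kernelClass_le hK hf B Q hε hεW
  · rintro _ ⟨t, h, -, rfl⟩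
    exact measurable_kernelFun (measurable_of_boundedVariationOn hK.boundedVariation)
      hf.measurable _ _ _
  · have hnorm : eLpNorm (fun _ : ℝ => totalVariationNorm K * √(supNorm f)) 2 Q =
        ENNReal.ofReal (totalVariationNorm K * √(supNorm f)) := by
      rw [eLpNorm_const _ (by norm_num) (IsProbabilityMeasure.ne_zero Q),
        Real.enorm_of_nonneg hW0]
      simp
    rw [hnorm] at hεW ⊢
    have hle := (ENNReal.ofReal_le_ofReal_iff hW0).1 hεW
    rw [← ENNReal.ofReal_mul (by norm_num), ← ENNReal.ofReal_div_of_pos hε,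
      ENNReal.ofReal_rpow_of_nonneg (by positivity) (by norm_num)]
    exact_mod_cast l2CoveringNumber_kernelClass_le hK hf B Q hε (by linarith)
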